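/- For positive integers $s_1,\dots,s_r$ let $$\zeta(s_1,\dots,s_r)=\sum_{n_1>n_2>\cdots>n_r>0}\frac1{n_1^{s_1}\cdots n_r^{s_r}} .$$ Let $m\ge 2$, let $k_1,\dots,k_m$ be positive integers with $k_2\ge 2$, and put $n_0:=k_1$. For $N\ge 0$ let $$A_N=\sum_{n_1=1}^{N}\binom{k_2+k_1-n_1-1}{k_1-1}\,\zeta(k_2+k_1-n_1,\,n_1,\,k_3,\dots,k_m),$$ $$B=\sum_{\kappa=2}^{m-1}\ \sum_{n_1=1}^{n_0}\sum_{n_2=1}^{n_1}\cdots\sum_{n_{\kappa-1}=1}^{n_{\kappa-2}}\ \sum_{n_\kappa=1}^{k_{\kappa+1}}\ \prod_{\lambda=2}^{\kappa}\binom{k_\lambda+n_{\lambda-2}-n_{\lambda-1}-1}{k_\lambda-1}\binom{k_{\kappa+1}+n_{\kappa-1}-n_\kappa-1}{n_{\kappa-1}-1}$$ $$\qquad\times\ \zeta(k_2+n_0-n_1,\,k_3+n_1-n_2,\dots,k_{\kappa+1}+n_{\kappa-1}-n_\kappa,\,n_\kappa,\,k_{\kappa+2},\dots,k_m),$$ $$C=\sum_{n_1=1}^{n_0}\sum_{n_2=1}^{n_1}\cdots\sum_{n_{m-1}=1}^{n_{m-2}}\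 \prod_{\lambda=2}^{m}\binom{k_\lambda+n_{\lambda-2}-n_{\lambda-1}-1}{k_\lambda-1}\ \zeta(k_2+n_0-n_1,\,k_3+n_1-n_2,\dots,k_m+n_{m-2}-n_{m-1},\,n_{m-1}).$$ (i) If $k_1\ge 2$, then $\zeta(k_1)$, $\zeta(k_2,\dots,k_m)$ and all the series $\zeta(\dots)$ occurring in $A_{k_2}$, $B$ and $C$ converge, and $$\zeta(k_1)\,\zeta(k_2,\dots,k_m)=A_{k_2}+B+C .$$ (ii) If $k_1=1$, then omitting the summand $n_1=k_2$ of $A_{k_2}$ (which is the formal divergent term $\zeta(1,k_2,\dots,k_m)$ with coefficient $1$) and replacing $\zeta(1)\zeta(k_2,\dots,k_m)-\zeta(1,k_2,\dots,k_m)$ by the sum on the left below gives $$\sum_{j=2}^{m}\bigl[\zeta(k_2,\dots,k_{j-1},k_j+1,k_{j+1},\dots,k_m)+\zeta(k_2,\dots,k_j,1,k_{j+1},\dots,k_m)\bigr]=A_{k_2-1}+B+C ;$$ all the series $\zeta(\dots)$ occurring in this equation converge, and the equation holds. -/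

import Mathlib

/-- The summation range of a multiple zeta value of length `r`: tuples of positive integers
`n_1 > n_2 > ⋯ > n_r > 0`. -/
abbrev MZVIndex (r : ℕ) : Type :=
  {n : Fin r → ℕ // StrictAnti n ∧ ∀ i, 0 < n i}

/-- The summand `1 / (n_1 ^ s_1 ⋯ n_r ^ s_r)` of the series `ζ(s_1, …, s_r)`. -/
noncomputable def mzvTerm (s : List ℕ) (n : MZVIndex s.length) : ℝ :=
  ∏ i : Fin s.length, 1 / (n.1 i : ℝ) ^ (s.get i)

/-- Convergence of the series `ζ(s_1, …, s_r)` (all its terms are positive). -/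
def MZVConverges (s : List ℕ) : Prop :=
  Summable (mzvTerm s)

/-- The Euler-Zagier sum (multiple zeta value)
`ζ(s_1, …, s_r) = ∑_{n_1 > ⋯ > n_r > 0} 1 / (n_1 ^ s_1 ⋯ n_r ^ s_r)`. -/
noncomputable def mzv (s : List ℕ) : ℝ :=
  ∑' n : MZVIndex s.length, mzvTerm s n

/-- The list `k_a, k_{a+1}, …, k_b` (empty if `b < a`). -/
def seg (k : ℕ → ℕ) (a b : ℕ) : List ℕ :=
  (List.range' a (b + 1 - a)).map k

/-- The range of the nested sums `∑_{n_1 = 1}^{b} ∑_{n_2 = 1}^{n_1} ⋯ ∑_{n_r = 1}^{n_{r-1}}`, as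
the finite set of lists `[n_1, …, n_r]`. -/
def chains : ℕ → ℕ → Finset (List ℕ)
  | 0, _ => {[]}
  | r + 1, b => (Finset.Icc 1 b).biUnion fun n => (chains r n).image fun l => n :: l

theorem mem_chains (r b : ℕ) (l : List ℕ) :
    l ∈ chains r b ↔ l.length = r ∧ (b :: l).Pairwise (· ≥ ·) ∧ ∀ x ∈ l, 1 ≤ x := by
  induction r generalizing b l with
  | zero => cases l <;> simp [chains]
  | succ r ih =>
    cases l with
    | nil => simp [chains]
    | cons x l =>
      simp only [chains, Finset.mem_biUnion, Finset.mem_Icc, Finset.mem_image, List.cons.injEq,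
        ih, List.length_cons, List.pairwise_cons, List.mem_cons]
      constructor
      · rintro ⟨a, ⟨h1, h2⟩, l', ⟨h3, ⟨h4, h5⟩, h6⟩, rfl, rfl⟩
        refine ⟨by omega, ⟨?_, h4, h5⟩, ?_⟩
        · rintro y (rfl | hy)
          · exact h2
          · exact le_trans (h4 y hy) h2
        · rintro y (rfl | hy)
          · exact h1
          · exact h6 y hy
      · rintro ⟨h1, ⟨h2, h3, h4⟩, h5⟩
        exact ⟨x, ⟨h5 x (Or.inl rfl), h2 x (Or.inl rfl)⟩, l,
          ⟨by omega, ⟨h3, h4⟩, fun y hy => h5 y (Or.inr hy)⟩, rfl, rfl⟩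

/-- The sequence `n_0 = k_1, n_1, n_2, …` with `n_1, n_2, …` the entries of the list `l`. -/
def idx (k : ℕ → ℕ) (l : List ℕ) (i : ℕ) : ℕ :=
  (k 1 :: l).getD i 0

/-- The argument list
`k_2 + n_0 - n_1, k_3 + n_1 - n_2, …, k_{κ+1} + n_{κ-1} - n_κ, n_κ, k_{κ+2}, …, k_m`. -/
def shiftArgs (k : ℕ → ℕ) (m κ : ℕ) (n : ℕ → ℕ) : List ℕ :=
  (List.range' 2 κ).map (fun j => k j + n (j - 2) - n (j - 1)) ++ n κ :: seg k (κ + 2) m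

/-- The product `∏_{j = 2}^{κ} binom(k_j + n_{j-2} - n_{j-1} - 1, k_j - 1)`. -/
def prodCoeff (k : ℕ → ℕ) (κ : ℕ) (n : ℕ → ℕ) : ℕ :=
  ∏ j ∈ Finset.Icc 2 κ, (k j + n (j - 2) - n (j - 1) - 1).choose (k j - 1)

/-- The first sum, with upper limit `N`:
`∑_{n = 1}^{N} binom(k_2 + k_1 - n - 1, k_1 - 1) ζ(k_2 + k_1 - n, n, k_3, …, k_m)`. -/
noncomputable def firstSum (k : ℕ → ℕ) (m N : ℕ) : ℝ :=
  ∑ n ∈ Finset.Icc 1 N,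
    ((k 2 + k 1 - n - 1).choose (k 1 - 1) : ℝ) * mzv ((k 2 + k 1 - n) :: n :: seg k 3 m)

/-- The middle sums, over `2 ≤ κ ≤ m - 1`; here `l = [n_1, …, n_{κ-1}]` and `q = n_κ`. -/
noncomputable def middleSum (k : ℕ → ℕ) (m : ℕ) : ℝ :=
  ∑ κ ∈ Finset.Icc 2 (m - 1), ∑ l ∈ chains (κ - 1) (k 1), ∑ q ∈ Finset.Icc 1 (k (κ + 1)),
    let n := idx k (l ++ [q])
    (prodCoeff k κ n : ℝ) * ((k (κ + 1) + n (κ - 1) - n κ - 1).choose (n (κ - 1) - 1) : ℝ) *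
      mzv (shiftArgs k m κ n)

/-- The last sum; here `l = [n_1, …, n_{m-1}]`. -/
noncomputable def lastSum (k : ℕ → ℕ) (m : ℕ) : ℝ :=
  ∑ l ∈ chains (m - 1) (k 1),
    (prodCoeff k m (idx k l) : ℝ) * mzv (shiftArgs k m (m - 1) (idx k l))

/-- Every multiple zeta value that occurs in `firstSum k m N`, `middleSum k m` and `lastSum k m`
is a convergent series. -/
def SumsConverge (k : ℕ → ℕ) (m N : ℕ) : Prop :=
  (∀ n ∈ Finset.Icc 1 N, MZVConverges ((k 2 + k 1 - n) :: n :: seg k 3 m)) ∧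
  (∀ κ ∈ Finset.Icc 2 (m - 1), ∀ l ∈ chains (κ - 1) (k 1), ∀ q ∈ Finset.Icc 1 (k (κ + 1)),
    MZVConverges (shiftArgs k m κ (idx k (l ++ [q])))) ∧
  (∀ l ∈ chains (m - 1) (k 1), MZVConverges (shiftArgs k m (m - 1) (idx k l)))

/-- The list `k_2, …, k_{j-1}, k_j + 1, k_{j+1}, …, k_m`. -/
def raiseArgs (k : ℕ → ℕ) (m j : ℕ) : List ℕ :=
  seg k 2 (j - 1) ++ (k j + 1) :: seg k (j + 1) m

/-- The list `k_2, …, k_j, 1, k_{j+1}, …, k_m`. -/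
def insertArgs (k : ℕ → ℕ) (m j : ℕ) : List ℕ :=
  seg k 2 j ++ 1 :: seg k (j + 1) m

/-! Every series is cut into layers according to its largest index, and the identity already holds
layer by layer. Multiply 1/x^{k_1} by the layer of ζ(k_2,…,k_m) with largest index y, fix d = x + y,
and expand 1/(x^{k_1} y^{k_2}) in partial fractions in d. The terms with a power of y are layers at
d of the series in A. The terms with a power x^q contain convolutions of the same kind for q, k_3,
…, k_m at all levels e < d. Iterating gives the finite identity `mzvConv_seg`, in which A is the
case κ = 1 of the family forming B. If k_1 ≥ 2, summing over d is a Cauchy product of convergent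
series. If k_1 = 1, the divergent term is subtracted inside each layer, which replaces 1/(d - c) by
1/(d - c) - 1/d. By Tonelli and telescoping, layer c of ζ(k_2,…,k_m) is then weighted by the
harmonic number H_c (`hasSum_sum_range_inv_sub_inv_mul`). Multiplying by H_c is a stuffle with a
truncated ζ(1) and produces the raised and inserted arguments (`mzvLayer_mul_sum_inv`). Convergence
follows because truncated sums with positive exponents grow more slowly than any power
(`exists_sum_range_mzvLayer_le`). -/

/-- The part of the series `ζ(s_1, …, s_r)` whose largest summation index equals `c`; the empty
list is treated as having largest index `0`. -/
noncomputable def mzvLayer : List ℕ → ℕ → ℝ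
  | [], c => if c = 0 then 1 else 0
  | s :: l, c => ((c : ℝ) ^ s)⁻¹ * ∑ b ∈ Finset.range c, mzvLayer l b

theorem mzvLayer_nonneg (l : List ℕ) (c : ℕ) : 0 ≤ mzvLayer l c := by
  induction l generalizing c with
  | nil => simp only [mzvLayer]; split_ifs <;> norm_num
  | cons s l ih => exact mul_nonneg (by positivity) (Finset.sum_nonneg fun b _ => ih b)

theorem sum_range_mzvLayer_nil (c : ℕ) :
    ∑ b ∈ Finset.range c, mzvLayer [] b = if c = 0 then 0 else 1 := by
  simp [mzvLayer, Finset.sum_ite_eq', Nat.pos_iff_ne_zero]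

theorem mzvLayer_singleton {n : ℕ} (hn : 1 ≤ n) (c : ℕ) : mzvLayer [n] c = ((c : ℝ) ^ n)⁻¹ := by
  rw [mzvLayer, sum_range_mzvLayer_nil]
  split_ifs with h
  · subst h; simp [show n ≠ 0 by omega]
  · simp

/-! ### Partial fractions, free of denominators. -/

section PartialFractions

variable {R : Type*} [CommRing R]

theorem partialFraction_aux_zero (Z Y : R) (k : ℕ) :
    ∑ i ∈ Finset.range (k + 1), ((0 + i).choose 0 : R) * Z ^ (0 + 1 + i) * Y ^ (k + 1 - i) =
      Z * Y ^ (k + 1) +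
        Z * ∑ i ∈ Finset.range k, ((0 + i).choose 0 : R) * Z ^ (0 + 1 + i) * Y ^ (k - i) := by
  rw [Finset.sum_range_succ', Finset.mul_sum, add_comm]
  congr 1
  · simp
  · refine Finset.sum_congr rfl fun i _ => ?_
    rw [show k + 1 - (i + 1) = k - i by omega]
    simp only [Nat.choose_zero_right]
    ring

/-- Pascal's rule: writing S(n,k) for these sums, S(n+1,k+1) = Z (S(n,k+1) + S(n+1,k)), the
recursion that XY = Z(X+Y) imposes on the monomials in X and Y. -/
theorem partialFraction_aux_succ (Z Y : R) (n k : ℕ) :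
    ∑ i ∈ Finset.range (k + 1),
        ((n + 1 + i).choose (n + 1) : R) * Z ^ (n + 1 + 1 + i) * Y ^ (k + 1 - i) =
      Z * (∑ i ∈ Finset.range (k + 1),
          ((n + i).choose n : R) * Z ^ (n + 1 + i) * Y ^ (k + 1 - i)) +
        Z * ∑ i ∈ Finset.range k,
          ((n + 1 + i).choose (n + 1) : R) * Z ^ (n + 1 + 1 + i) * Y ^ (k - i) := by
  have h : ∑ i ∈ Finset.range k,
        ((n + 1 + (i + 1)).choose (n + 1) : R) * Z ^ (n + 1 + 1 + (i + 1)) * Y ^ (k + 1 - (i + 1)) =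
      Z * (∑ i ∈ Finset.range k,
          ((n + (i + 1)).choose n : R) * Z ^ (n + 1 + (i + 1)) * Y ^ (k + 1 - (i + 1))) +
        Z * ∑ i ∈ Finset.range k,
          ((n + 1 + i).choose (n + 1) : R) * Z ^ (n + 1 + 1 + i) * Y ^ (k - i) := by
    rw [← mul_add, ← Finset.sum_add_distrib, Finset.mul_sum]
    refine Finset.sum_congr rfl fun i _ => ?_
    rw [show n + 1 + (i + 1) = (n + (i + 1)) + 1 by omega, Nat.choose_succ_succ,
      show n + (i + 1) = n + 1 + i by omega, show k + 1 - (i + 1) = k - i by omega]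
    push_cast
    ring
  rw [Finset.sum_range_succ', Finset.sum_range_succ' (fun i => ((n + i).choose n : R) * _ * _), h]
  simp only [add_zero, Nat.choose_self]
  ring

/-- Applied with X = 1/x, Y = 1/y, Z = 1/(x+y). Both sides satisfy the same recursion in (n,k),
hence the double induction. -/
theorem partialFraction_of_mul_eq {X Y Z : R} (h : X * Y = Z * (X + Y)) (n k : ℕ) :
    X ^ (n + 1) * Y ^ (k + 1) =
      ∑ i ∈ Finset.range (k + 1), ((n + i).choose n : R) * Z ^ (n + 1 + i) * Y ^ (k + 1 - i) +
      ∑ i ∈ Finset.range (n + 1), ((k + i).choose k : R) * Z ^ (k + 1 + i) * X ^ (n + 1 - i) := by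
  induction n generalizing k with
  | zero =>
    induction k with
    | zero => simp; linear_combination h
    | succ k ih =>
      rw [partialFraction_aux_zero, partialFraction_aux_succ]
      simp only [Finset.sum_range_zero]
      linear_combination Z * ih + Y ^ (k + 1) * h
  | succ n ihn =>
    induction k with
    | zero =>
      rw [partialFraction_aux_zero, partialFraction_aux_succ]
      simp only [Finset.sum_range_zero]
      linear_combination Z * ihn 0 + X ^ (n + 1) * h
    | succ k ih =>
      rw [partialFraction_aux_succ, partialFraction_aux_succ Z X k (n + 1)]
      linear_combination Z * ih + Z * ihn (k + 1) + X ^ (n + 1) * Y ^ (k + 1) * h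

end PartialFractions

theorem sum_Icc_one_eq_sum_range_reflect {M : Type*} [AddCommMonoid M] (f : ℕ → M) (k : ℕ) :
    ∑ q ∈ Finset.Icc 1 k, f q = ∑ i ∈ Finset.range k, f (k - i) := by
  refine Finset.sum_nbij' (fun q => k - q) (fun i => k - i) ?_ ?_ ?_ ?_ ?_
  · intro q hq; simp only [Finset.mem_Icc, Finset.mem_range] at *; omega
  · intro q hq; simp only [Finset.mem_Icc, Finset.mem_range] at *; omega
  · intro q hq; simp only [Finset.mem_Icc] at *; omega
  · intro q hq; simp only [Finset.mem_range] at *; omega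
  · intro q hq; simp only [Finset.mem_Icc] at *; congr 1; omega

/-- The partial fraction decomposition of `1 / (x ^ n y ^ k)` in terms of `x + y`. -/
theorem partialFraction {x y : ℝ} (hx : 0 < x) (hy : 0 < y) {n k : ℕ} (hn : 1 ≤ n) (hk : 1 ≤ k) :
    (x ^ n)⁻¹ * (y ^ k)⁻¹ =
      ∑ q ∈ Finset.Icc 1 k,
        ((k + n - q - 1).choose (n - 1) : ℝ) * (((x + y) ^ (k + n - q))⁻¹ * (y ^ q)⁻¹) +
      ∑ q ∈ Finset.Icc 1 n,
        ((k + n - q - 1).choose (k - 1) : ℝ) * (((x + y) ^ (k + n - q))⁻¹ * (x ^ q)⁻¹) := by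
  obtain ⟨n, rfl⟩ := Nat.exists_eq_add_of_le' hn
  obtain ⟨k, rfl⟩ := Nat.exists_eq_add_of_le' hk
  have h : x⁻¹ * y⁻¹ = (x + y)⁻¹ * (x⁻¹ + y⁻¹) := by field_simp; ring
  have := partialFraction_of_mul_eq h n k
  simp only [← inv_pow]
  rw [this, sum_Icc_one_eq_sum_range_reflect, sum_Icc_one_eq_sum_range_reflect]
  congr 1
  · refine Finset.sum_congr rfl fun i hi => ?_
    have := Finset.mem_range.1 hi
    rw [show k + 1 + (n + 1) - (k + 1 - i) = n + 1 + i by omega,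
      show n + 1 + i - 1 = n + i by omega, Nat.add_sub_cancel]
    ring
  · refine Finset.sum_congr rfl fun i hi => ?_
    have := Finset.mem_range.1 hi
    rw [show k + 1 + (n + 1) - (n + 1 - i) = k + 1 + i by omega,
      show k + 1 + i - 1 = k + i by omega, Nat.add_sub_cancel]
    ring

/-! ### Convolution of layers and its recursion. -/

/-- The part of the product `ζ(n) ζ(l)` for which the largest indices have sum `d`. -/
noncomputable def mzvConv (n : ℕ) (l : List ℕ) (d : ℕ) : ℝ :=
  ∑ x ∈ Finset.HasAntidiagonal.antidiagonal d, mzvLayer [n] x.1 * mzvLayer l x.2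

/-- Triples (a,c,b) with a + c = d and b < c are regrouped by e = a + b < d. -/
theorem sum_antidiagonal_mul_sum_range (f g : ℕ → ℝ) (d : ℕ) :
    ∑ x ∈ Finset.HasAntidiagonal.antidiagonal d, f x.1 * ∑ b ∈ Finset.range x.2, g b =
      ∑ e ∈ Finset.range d, ∑ x ∈ Finset.HasAntidiagonal.antidiagonal e, f x.1 * g x.2 := by
  induction d with
  | zero => simp
  | succ d ih =>
    rw [Finset.Nat.sum_antidiagonal_succ', Finset.sum_range_succ, ← ih, ← Finset.sum_add_distrib]
    simp [Finset.sum_range_succ, mul_add]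

theorem sum_antidiagonal_eq_sum_range {f : ℕ → ℝ} (hf : f 0 = 0) (g : ℕ → ℝ) (d : ℕ) :
    ∑ x ∈ Finset.HasAntidiagonal.antidiagonal d, f x.1 * g x.2 = ∑ c ∈ Finset.range d, f (d - c) * g c := by
  rw [← Finset.Nat.sum_antidiagonal_swap, Finset.Nat.sum_antidiagonal_eq_sum_range_succ_mk,
    Finset.sum_range_succ]
  simp [hf]

theorem mzvConv_eq_sum_range {n : ℕ} (hn : 1 ≤ n) (l : List ℕ) (d : ℕ) :
    mzvConv n l d = ∑ c ∈ Finset.range d, (((d - c : ℕ) : ℝ) ^ n)⁻¹ * mzvLayer l c := by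
  rw [mzvConv, sum_antidiagonal_eq_sum_range (by simp [mzvLayer])]
  simp only [mzvLayer_singleton hn]

theorem mzvConv_nil (n d : ℕ) : mzvConv n [] d = mzvLayer [n] d := by
  rw [mzvConv, Finset.sum_eq_single (d, 0)]
  · simp [mzvLayer]
  · rintro ⟨a, c⟩ h1 h2
    rw [Finset.HasAntidiagonal.mem_antidiagonal] at h1
    have : c ≠ 0 := by rintro rfl; simp_all
    simp [mzvLayer, this]
  · simp

/-- The recursive step: partial fractions at x = d - c, y = c. Powers of y close up to layers;
powers of x leave a convolution with the shorter list `l`. -/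
theorem mzvConv_cons {n k : ℕ} (hn : 1 ≤ n) (hk : 1 ≤ k) (l : List ℕ) (d : ℕ) :
    mzvConv n (k :: l) d =
      ∑ q ∈ Finset.Icc 1 k,
        ((k + n - q - 1).choose (n - 1) : ℝ) * mzvLayer ((k + n - q) :: q :: l) d +
      ∑ q ∈ Finset.Icc 1 n, ((k + n - q - 1).choose (k - 1) : ℝ) *
        (((d : ℝ) ^ (k + n - q))⁻¹ * ∑ e ∈ Finset.range d, mzvConv q l e) := by
  have h2 : ∀ q ∈ Finset.Icc 1 n, ∑ e ∈ Finset.range d, mzvConv q l e =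
      ∑ c ∈ Finset.range d, (((d - c : ℕ) : ℝ) ^ q)⁻¹ * ∑ b ∈ Finset.range c, mzvLayer l b := by
    intro q hq
    simp only [mzvConv]
    rw [← sum_antidiagonal_mul_sum_range, sum_antidiagonal_eq_sum_range (by simp [mzvLayer])
      (fun c => ∑ b ∈ Finset.range c, mzvLayer l b)]
    simp only [mzvLayer_singleton (Finset.mem_Icc.1 hq).1]
  rw [mzvConv_eq_sum_range hn,
    Finset.sum_congr (s₁ := Finset.Icc 1 n) rfl fun q hq => by rw [h2 q hq]]
  simp only [mzvLayer, Finset.mul_sum (Finset.range d)]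
  rw [Finset.sum_comm, Finset.sum_comm (s := Finset.Icc 1 n), ← Finset.sum_add_distrib]
  refine Finset.sum_congr rfl fun c hc => ?_
  have hcd := Finset.mem_range.1 hc
  -- At c = 0 partial fractions are unavailable, but all terms vanish because the inner sum over b <
  -- 0 is empty.
  rcases Nat.eq_zero_or_pos c with rfl | hc0
  · simp
  have hx : (0 : ℝ) < ((d - c : ℕ) : ℝ) := by exact_mod_cast Nat.sub_pos_of_lt hcd
  have hy : (0 : ℝ) < (c : ℝ) := by exact_mod_cast hc0
  have hd : ((d - c : ℕ) : ℝ) + c = d := by rw [Nat.cast_sub hcd.le]; ring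
  rw [← mul_assoc, partialFraction hx hy hn hk, hd, add_mul, Finset.sum_mul, Finset.sum_mul]
  congr 1 <;> exact Finset.sum_congr rfl fun q _ => by ring

/-! ### Peeling the outermost index off the nested sums. -/

/-- The sequence `a, k_3, k_4, …`. -/
def advance (k : ℕ → ℕ) (a i : ℕ) : ℕ := if i = 1 then a else k (i + 1)

theorem seg_succ_succ (k : ℕ → ℕ) (a i m : ℕ) (hi : 2 ≤ i) :
    seg k (i + 1) (m + 1) = seg (advance k a) i m := by
  rw [seg, seg, show m + 1 + 1 - (i + 1) = m + 1 - i by omega,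
    List.range'_succ_left, List.map_map]
  refine List.map_congr_left fun j hj => ?_
  have := (List.mem_range'_1.1 hj).1
  simp [advance, show j ≠ 1 by omega]

theorem seg_of_le (k : ℕ → ℕ) {a b : ℕ} (h : a ≤ b) : seg k a b = k a :: seg k (a + 1) b := by
  rw [seg, seg, show b + 1 - a = (b + 1 - (a + 1)) + 1 by omega, List.range'_succ, List.map_cons]

theorem seg_of_lt (k : ℕ → ℕ) {a b : ℕ} (h : b < a) : seg k a b = [] := by
  simp [seg, show b + 1 - a = 0 by omega]

theorem idx_cons (k : ℕ → ℕ) (a : ℕ) (l : List ℕ) (i : ℕ) :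
    idx k (a :: l) (i + 1) = idx (advance k a) l i := by
  simp [idx, advance]

/-- Once n_1 = a is fixed, what remains is the same construction for the data a, k_3, k_4, …. -/
theorem shiftArgs_succ (k : ℕ → ℕ) (m κ a : ℕ) (l : List ℕ) :
    shiftArgs k (m + 1) (κ + 1) (idx k (a :: l)) =
      (k 2 + k 1 - a) :: shiftArgs (advance k a) m κ (idx (advance k a) l) := by
  rw [shiftArgs, shiftArgs, List.range'_succ, List.map_cons, List.cons_append, idx_cons,
    ← seg_succ_succ k a (κ + 2) m (by omega)]
  congr 2
  rw [List.range'_succ_left, List.map_map]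
  refine List.map_congr_left fun j hj => ?_
  have := (List.mem_range'_1.1 hj).1
  rw [Function.comp, show j + 1 - 2 = (j - 2) + 1 by omega, show j + 1 - 1 = (j - 1) + 1 by omega,
    idx_cons, idx_cons]
  simp [advance, show j ≠ 1 by omega]

theorem prodCoeff_succ (k : ℕ → ℕ) (κ a : ℕ) (l : List ℕ) :
    prodCoeff k (κ + 2) (idx k (a :: l)) =
      (k 2 + k 1 - a - 1).choose (k 2 - 1) *
        prodCoeff (advance k a) (κ + 1) (idx (advance k a) l) := by
  rw [prodCoeff, prodCoeff, ← Finset.Ioc_insert_left (by omega : 2 ≤ κ + 2),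
    Finset.prod_insert (by simp)]
  congr 1
  refine Finset.prod_nbij' (fun j => j - 1) (fun j => j + 1) ?_ ?_ ?_ ?_ ?_
  · intro q hq; simp only [Finset.mem_Icc, Finset.mem_Ioc] at *; omega
  · intro q hq; simp only [Finset.mem_Icc, Finset.mem_Ioc] at *; omega
  · intro q hq; simp only [Finset.mem_Ioc] at *; omega
  · intro q hq; simp only [Finset.mem_Icc] at *; omega
  · intro q hq
    simp only [Finset.mem_Ioc] at hq
    obtain ⟨j, rfl⟩ := Nat.exists_eq_add_of_le' (show 3 ≤ q by omega)
    rw [show j + 3 - 2 = j + 1 by omega, show j + 3 - 1 = j + 1 + 1 by omega, idx_cons, idx_cons]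
    simp [advance]

theorem sum_chains_succ {M : Type*} [AddCommMonoid M] (r b : ℕ) (f : List ℕ → M) :
    ∑ l ∈ chains (r + 1) b, f l = ∑ n ∈ Finset.Icc 1 b, ∑ l ∈ chains r n, f (n :: l) := by
  rw [chains, Finset.sum_biUnion]
  · refine Finset.sum_congr rfl fun n _ => ?_
    rw [Finset.sum_image]
    intro x _ y _ h
    exact (List.cons.inj h).2
  · intro x _ y _ hxy
    refine Finset.disjoint_left.2 fun l hx hy => hxy ?_
    simp only [Finset.mem_image] at hx hy
    obtain ⟨l1, _, rfl⟩ := hx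
    obtain ⟨l2, _, h⟩ := hy
    exact (List.cons.inj h).1.symm

/-- The summand of index `κ` of `middleSum`, with an arbitrary function in place of `mzv`. -/
noncomputable def middleTerm (F : List ℕ → ℝ) (k : ℕ → ℕ) (m κ : ℕ) : ℝ :=
  ∑ l ∈ chains (κ - 1) (k 1), ∑ q ∈ Finset.Icc 1 (k (κ + 1)),
    let n := idx k (l ++ [q])
    (prodCoeff k κ n : ℝ) * ((k (κ + 1) + n (κ - 1) - n κ - 1).choose (n (κ - 1) - 1) : ℝ) *
      F (shiftArgs k m κ n)

/-- `lastSum`, with an arbitrary function in place of `mzv`. -/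
noncomputable def lastTerm (F : List ℕ → ℝ) (k : ℕ → ℕ) (m : ℕ) : ℝ :=
  ∑ l ∈ chains (m - 1) (k 1),
    (prodCoeff k m (idx k l) : ℝ) * F (shiftArgs k m (m - 1) (idx k l))

/-- Identifies the sum A with the missing case κ = 1 of the middle sums, so that one induction
handles both. -/
theorem middleTerm_one (F : List ℕ → ℝ) (k : ℕ → ℕ) (m : ℕ) :
    middleTerm F k m 1 = ∑ q ∈ Finset.Icc 1 (k 2),
      ((k 2 + k 1 - q - 1).choose (k 1 - 1) : ℝ) * F ((k 2 + k 1 - q) :: q :: seg k 3 m) := by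
  simp [middleTerm, chains, prodCoeff, shiftArgs, idx]

/-- The function `F` is arbitrary because peeling off an index replaces it by `F` with one argument
prepended. -/
theorem middleTerm_succ (F : List ℕ → ℝ) (k : ℕ → ℕ) (m κ : ℕ) :
    middleTerm F k (m + 1) (κ + 1 + 1) = ∑ a ∈ Finset.Icc 1 (k 1),
      ((k 2 + k 1 - a - 1).choose (k 2 - 1) : ℝ) *
        middleTerm (fun l => F ((k 2 + k 1 - a) :: l)) (advance k a) m (κ + 1) := by
  rw [middleTerm, show κ + 1 + 1 - 1 = κ + 1 by omega, sum_chains_succ]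
  refine Finset.sum_congr rfl fun a _ => ?_
  simp only [middleTerm, Finset.mul_sum, Nat.add_sub_cancel, List.cons_append]
  have h1 : advance k a 1 = a := by simp [advance]
  have h2 : advance k a (κ + 1 + 1) = k (κ + 1 + 1 + 1) := by simp [advance]
  rw [h1, h2]
  refine Finset.sum_congr rfl fun l _ => Finset.sum_congr rfl fun q _ => ?_
  rw [prodCoeff_succ, shiftArgs_succ, idx_cons, idx_cons]
  push_cast
  ring

theorem lastTerm_one (F : List ℕ → ℝ) (k : ℕ → ℕ) : lastTerm F k 1 = F [k 1] := by
  simp [lastTerm, chains, prodCoeff, shiftArgs, idx, seg]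

theorem lastTerm_succ (F : List ℕ → ℝ) (k : ℕ → ℕ) (m : ℕ) :
    lastTerm F k (m + 2) = ∑ a ∈ Finset.Icc 1 (k 1),
      ((k 2 + k 1 - a - 1).choose (k 2 - 1) : ℝ) *
        lastTerm (fun l => F ((k 2 + k 1 - a) :: l)) (advance k a) (m + 1) := by
  rw [lastTerm, show m + 2 - 1 = m + 1 by omega, sum_chains_succ]
  refine Finset.sum_congr rfl fun a _ => ?_
  simp only [lastTerm, Finset.mul_sum, Nat.add_sub_cancel]
  have h1 : advance k a 1 = a := by simp [advance]
  rw [h1]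
  refine Finset.sum_congr rfl fun l _ => ?_
  rw [prodCoeff_succ, shiftArgs_succ]
  push_cast
  ring

theorem middleTerm_mzvLayer_cons (k : ℕ → ℕ) (m κ s d : ℕ) :
    middleTerm (fun l => mzvLayer (s :: l) d) k m κ =
      ((d : ℝ) ^ s)⁻¹ * ∑ e ∈ Finset.range d, middleTerm (mzvLayer · e) k m κ := by
  simp only [middleTerm, mzvLayer, Finset.mul_sum]
  rw [Finset.sum_comm (s := Finset.range d)]
  refine Finset.sum_congr rfl fun l _ => ?_
  rw [Finset.sum_comm (s := Finset.range d)]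
  exact Finset.sum_congr rfl fun q _ => Finset.sum_congr rfl fun e _ => by ring

theorem lastTerm_mzvLayer_cons (k : ℕ → ℕ) (m s d : ℕ) :
    lastTerm (fun l => mzvLayer (s :: l) d) k m =
      ((d : ℝ) ^ s)⁻¹ * ∑ e ∈ Finset.range d, lastTerm (mzvLayer · e) k m := by
  simp only [lastTerm, mzvLayer, Finset.mul_sum]
  rw [Finset.sum_comm (s := Finset.range d)]
  exact Finset.sum_congr rfl fun q _ => Finset.sum_congr rfl fun e _ => by ring

/-- The shuffle product of a single zeta value with a multiple zeta value, layer by layer. -/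
theorem mzvConv_seg (m : ℕ) (k : ℕ → ℕ) (hk : ∀ i ∈ Finset.Icc 1 (m + 1), 1 ≤ k i) (d : ℕ) :
    mzvConv (k 1) (seg k 2 (m + 1)) d =
      ∑ κ ∈ Finset.range m, middleTerm (mzvLayer · d) k (m + 1) (κ + 1) +
        lastTerm (mzvLayer · d) k (m + 1) := by
  induction m generalizing k d with
  | zero => simp [lastTerm_one, seg_of_lt, mzvConv_nil]
  | succ m ih =>
    have h1 : 1 ≤ k 1 := hk 1 (by simp)
    have h2 : 1 ≤ k 2 := hk 2 (by simp)
    rw [seg_of_le k (by omega : 2 ≤ m + 1 + 1), mzvConv_cons h1 h2, Finset.sum_range_succ',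
      middleTerm_one, lastTerm_succ,
      show ∀ x y z : ℝ, x + y + z = y + (x + z) from fun x y z => by ring]
    congr 1
    rw [Finset.sum_congr rfl fun κ _ => middleTerm_succ .., Finset.sum_comm, ← Finset.sum_add_distrib]
    refine Finset.sum_congr rfl fun a ha => ?_
    rw [← Finset.mul_sum, ← mul_add]
    congr 1
    rw [Finset.sum_congr rfl fun κ _ => middleTerm_mzvLayer_cons .., lastTerm_mzvLayer_cons]
    rw [← Finset.mul_sum, ← mul_add, Finset.sum_comm, ← Finset.sum_add_distrib]
    congr 1
    refine Finset.sum_congr rfl fun e _ => ?_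
    -- The induction hypothesis is used for the data a, k_3, k_4, … at each lower level e < d.
    rw [← ih, ← seg_succ_succ k a 2 (m + 1) le_rfl]
    · simp [advance]
    · intro i hi
      rw [Finset.mem_Icc] at hi
      unfold advance
      split_ifs
      · exact (Finset.mem_Icc.1 ha).1
      · exact hk _ (Finset.mem_Icc.2 (by omega))

/-! ### Comparing the series over tuples with the series of layers. -/

/-- The largest index of a tuple (`0` for the empty tuple). -/
def MZVIndex.top : {r : ℕ} → MZVIndex r → ℕ
  | 0, _ => 0
  | _ + 1, n => n.1 0

theorem MZVIndex.le_top {r : ℕ} (n : MZVIndex r) (i : Fin r) : n.1 i ≤ n.top := by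
  cases r with
  | zero => exact i.elim0
  | succ r => exact n.2.1.antitone (Fin.zero_le i)

/-- Splitting off the largest index of a tuple. -/
def MZVIndex.consEquiv (r : ℕ) : MZVIndex (r + 1) ≃ {x : ℕ × MZVIndex r // x.2.top < x.1} where
  toFun n := ⟨(n.1 0, ⟨fun i => n.1 i.succ,
    fun _ _ h => n.2.1 (Fin.succ_lt_succ_iff.2 h), fun i => n.2.2 i.succ⟩), by
      cases r with
      | zero => exact n.2.2 0
      | succ r => exact n.2.1 (Fin.succ_pos 0)⟩
  invFun x := ⟨Fin.cons x.1.1 x.1.2.1, by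
    constructor
    · intro i j hij
      induction j using Fin.cases with
      | zero => exact absurd hij (Fin.not_lt_zero i)
      | succ j =>
        induction i using Fin.cases with
        | zero => simpa using (x.1.2.le_top j).trans_lt x.2
        | succ i => simpa using x.1.2.2.1 (Fin.succ_lt_succ_iff.1 hij)
    · intro i
      induction i using Fin.cases with
      | zero => simpa using Nat.zero_lt_of_lt x.2
      | succ i => simpa using x.1.2.2.2 i⟩
  left_inv n := by
    ext i
    induction i using Fin.cases <;> simp
  right_inv x := by
    ext <;> simp

theorem mzvTerm_nonneg (s : List ℕ) (n : MZVIndex s.length) : 0 ≤ mzvTerm s n :=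
  Finset.prod_nonneg fun _ _ => by positivity

theorem mzvTerm_cons (a : ℕ) (s : List ℕ) (x : {x : ℕ × MZVIndex s.length // x.2.top < x.1}) :
    mzvTerm (a :: s) ((MZVIndex.consEquiv s.length).symm x) =
      ((x.1.1 : ℝ) ^ a)⁻¹ * mzvTerm s x.1.2 := by
  simp only [mzvTerm, List.length_cons]
  rw [Fin.prod_univ_succ]
  simp [MZVIndex.consEquiv]

open scoped ENNReal in
-- The weight `g` makes the induction close: it can encode that the next index exceeds the top of
-- the tail. Values in `ℝ≥0∞` allow rearranging before convergence is known.
theorem tsum_ofReal_mzvTerm_mul (s : List ℕ) (g : ℕ → ℝ≥0∞) :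
    ∑' n : MZVIndex s.length, ENNReal.ofReal (mzvTerm s n) * g n.top =
      ∑' c, ENNReal.ofReal (mzvLayer s c) * g c := by
  induction s generalizing g with
  | nil =>
    have : Unique (MZVIndex ([] : List ℕ).length) :=
      { default := ⟨Fin.elim0, fun i => i.elim0, fun i => i.elim0⟩
        uniq := fun n => Subtype.ext (funext fun i => i.elim0) }
    rw [tsum_eq_single (β := ℕ) 0 (fun c hc => by simp [mzvLayer, hc]), tsum_fintype,
      Fintype.sum_unique]
    simp [mzvTerm, mzvLayer, MZVIndex.top]
  | cons a s ih =>
    refine ((MZVIndex.consEquiv s.length).symm.tsum_eq _).symm.trans ?_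
    have h1 : ∀ x : {x : ℕ × MZVIndex s.length // x.2.top < x.1},
        ENNReal.ofReal (mzvTerm (a :: s) ((MZVIndex.consEquiv s.length).symm x)) *
          g ((MZVIndex.consEquiv s.length).symm x).top =
        (fun x : ℕ × MZVIndex s.length => ENNReal.ofReal (((x.1 : ℝ) ^ a)⁻¹) *
          (ENNReal.ofReal (mzvTerm s x.2) * g x.1)) x.1 := by
      intro x
      rw [mzvTerm_cons, ENNReal.ofReal_mul (by positivity), mul_assoc]
      rfl
    refine (tsum_congr h1).trans
      ((tsum_subtype {x : ℕ × MZVIndex s.length | x.2.top < x.1} fun x =>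
        ENNReal.ofReal (((x.1 : ℝ) ^ a)⁻¹) * (ENNReal.ofReal (mzvTerm s x.2) * g x.1)).trans ?_)
    rw [ENNReal.tsum_prod']
    refine tsum_congr fun c => ?_
    have h2 : ∀ n : MZVIndex s.length,
        Set.indicator {x : ℕ × MZVIndex s.length | x.2.top < x.1}
          (fun x => ENNReal.ofReal (((x.1 : ℝ) ^ a)⁻¹) *
            (ENNReal.ofReal (mzvTerm s x.2) * g x.1)) (c, n) =
        ENNReal.ofReal (((c : ℝ) ^ a)⁻¹) * g c *
          (ENNReal.ofReal (mzvTerm s n) * if n.top < c then 1 else 0) := by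
      intro n
      by_cases h : n.top < c
      · simp [h]; ring
      · simp [h]
    rw [tsum_congr h2, ENNReal.tsum_mul_left, ih (fun b => if b < c then 1 else 0),
      tsum_eq_sum (s := Finset.range c) (fun b hb => by simp_all), mzvLayer,
      ENNReal.ofReal_mul (by positivity),
      ENNReal.ofReal_sum_of_nonneg fun b _ => mzvLayer_nonneg s b, mul_right_comm]
    congr 2
    exact Finset.sum_congr rfl fun b hb => by simp [Finset.mem_range.1 hb]

theorem tsum_ofReal_mzvTerm (s : List ℕ) :
    ∑' n : MZVIndex s.length, ENNReal.ofReal (mzvTerm s n) =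
      ∑' c, ENNReal.ofReal (mzvLayer s c) := by
  simpa using tsum_ofReal_mzvTerm_mul s 1

theorem summable_iff_tsum_ofReal_ne_top {ι : Type*} {f : ι → ℝ} (hf : ∀ i, 0 ≤ f i) :
    Summable f ↔ ∑' i, ENNReal.ofReal (f i) ≠ ⊤ := by
  refine ⟨fun h => h.tsum_ofReal_ne_top, fun h => ?_⟩
  simpa [ENNReal.toReal_ofReal (hf _)] using ENNReal.summable_toReal h

theorem mzvConverges_iff (s : List ℕ) : MZVConverges s ↔ Summable (mzvLayer s) := by
  rw [MZVConverges, summable_iff_tsum_ofReal_ne_top (mzvTerm_nonneg s),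
    summable_iff_tsum_ofReal_ne_top (mzvLayer_nonneg s), tsum_ofReal_mzvTerm]

theorem MZVConverges.hasSum {s : List ℕ} (h : MZVConverges s) : HasSum (mzvLayer s) (mzv s) := by
  have h' := (mzvConverges_iff s).1 h
  have : mzv s = ∑' c, mzvLayer s c := by
    rw [mzv, ← ENNReal.toReal_ofReal (tsum_nonneg (mzvTerm_nonneg s)),
      ENNReal.ofReal_tsum_of_nonneg (mzvTerm_nonneg s) h, tsum_ofReal_mzvTerm,
      ← ENNReal.ofReal_tsum_of_nonneg (mzvLayer_nonneg s) h',
      ENNReal.toReal_ofReal (tsum_nonneg (mzvLayer_nonneg s))]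
  rw [this]
  exact h'.hasSum

/-! ### Growth bounds and convergence. -/

/-- Half of ε is spent on the tail: b⁻¹ b^{ε/2} = b^ε b^{-(1+ε/2)}, where b^ε ≤ c^ε and the other
factor is summable. -/
theorem exists_sum_range_mzvLayer_le (l : List ℕ) (hl : ∀ s ∈ l, 1 ≤ s) {ε : ℝ} (hε : 0 < ε) :
    ∃ C : ℝ, 0 ≤ C ∧ ∀ c : ℕ, ∑ b ∈ Finset.range c, mzvLayer l b ≤ C * (c : ℝ) ^ ε := by
  induction l generalizing ε with
  | nil =>
    refine ⟨1, zero_le_one, fun c => ?_⟩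
    rw [sum_range_mzvLayer_nil, one_mul]
    split_ifs with h
    · positivity
    · exact Real.one_le_rpow (by exact_mod_cast Nat.one_le_iff_ne_zero.2 h) hε.le
  | cons s l ih =>
    obtain ⟨C, hC, h⟩ := ih (fun x hx => hl x (List.mem_cons_of_mem _ hx)) (half_pos hε)
    have hs : 1 ≤ s := hl s List.mem_cons_self
    have hsum : Summable fun n : ℕ => (n : ℝ) ^ (-(1 + ε / 2)) :=
      Real.summable_nat_rpow.2 (by linarith)
    refine ⟨C * ∑' n : ℕ, (n : ℝ) ^ (-(1 + ε / 2)),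
      mul_nonneg hC (tsum_nonneg fun n => by positivity), fun c => ?_⟩
    calc ∑ b ∈ Finset.range c, mzvLayer (s :: l) b
        ≤ ∑ b ∈ Finset.range c, C * (c : ℝ) ^ ε * (b : ℝ) ^ (-(1 + ε / 2)) := by
          refine Finset.sum_le_sum fun b hb => ?_
          rw [mzvLayer]
          rcases Nat.eq_zero_or_pos b with rfl | hb0
          · simp only [Finset.range_zero, Finset.sum_empty, mul_zero]; positivity
          have hb1 : (1 : ℝ) ≤ b := by exact_mod_cast hb0
          have hb2 : (0 : ℝ) < b := by linarith
          have hbc : (b : ℝ) ≤ c := by exact_mod_cast (Finset.mem_range.1 hb).le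
          calc ((b : ℝ) ^ s)⁻¹ * ∑ x ∈ Finset.range b, mzvLayer l x
              ≤ (b : ℝ)⁻¹ * (C * (b : ℝ) ^ (ε / 2)) := by
                refine mul_le_mul ?_ (h b) (Finset.sum_nonneg fun x _ => mzvLayer_nonneg l x)
                  (by positivity)
                exact inv_anti₀ hb2 (le_self_pow₀ hb1 (by omega))
            _ = C * ((b : ℝ) ^ ε * (b : ℝ) ^ (-(1 + ε / 2))) := by
                rw [← Real.rpow_neg_one, mul_left_comm, ← Real.rpow_add hb2, ← Real.rpow_add hb2]
                ring_nf
            _ ≤ C * ((c : ℝ) ^ ε * (b : ℝ) ^ (-(1 + ε / 2))) := by gcongr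
            _ = _ := by ring
      _ = C * (c : ℝ) ^ ε * ∑ b ∈ Finset.range c, (b : ℝ) ^ (-(1 + ε / 2)) :=
          (Finset.mul_sum ..).symm
      _ ≤ C * (c : ℝ) ^ ε * ∑' n : ℕ, (n : ℝ) ^ (-(1 + ε / 2)) := by
          gcongr
          exact hsum.sum_le_tsum _ fun n _ => by positivity
      _ = _ := by ring

/-- With ε = 1/2 in the growth bound, layer c is O(c^{-3/2}). -/
theorem mzvConverges_cons {s : ℕ} {l : List ℕ} (hs : 2 ≤ s) (hl : ∀ x ∈ l, 1 ≤ x) :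
    MZVConverges (s :: l) := by
  rw [mzvConverges_iff]
  obtain ⟨C, hC, h⟩ := exists_sum_range_mzvLayer_le l hl (half_pos one_pos)
  have hsum : Summable fun n : ℕ => C * (n : ℝ) ^ (-(3 / 2) : ℝ) :=
    (Real.summable_nat_rpow.2 (by norm_num)).mul_left C
  refine hsum.of_nonneg_of_le (mzvLayer_nonneg _) fun c => ?_
  rw [mzvLayer]
  rcases Nat.eq_zero_or_pos c with rfl | hc
  · simp only [Finset.range_zero, Finset.sum_empty, mul_zero]; positivity
  have hc1 : (1 : ℝ) ≤ c := by exact_mod_cast hc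
  have hc2 : (0 : ℝ) < c := by linarith
  calc ((c : ℝ) ^ s)⁻¹ * ∑ x ∈ Finset.range c, mzvLayer l x
      ≤ ((c : ℝ) ^ 2)⁻¹ * (C * (c : ℝ) ^ ((1 : ℝ) / 2)) := by
        refine mul_le_mul ?_ (h c) (Finset.sum_nonneg fun x _ => mzvLayer_nonneg l x)
          (by positivity)
        exact inv_anti₀ (by positivity) (pow_le_pow_right₀ hc1 hs)
    _ = C * (c : ℝ) ^ (-(3 / 2) : ℝ) := by
        rw [mul_left_comm, ← Real.rpow_natCast, ← Real.rpow_neg hc2.le, ← Real.rpow_add hc2]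
        norm_num

/-! ### Stuffle product with a truncated ζ(1). -/

/-- The sum of `F` over the lists obtained from `l` by raising one entry by `1` or by inserting
an entry `1` somewhere behind the first entry. -/
noncomputable def stuffleSum : (List ℕ → ℝ) → List ℕ → ℝ
  | _, [] => 0
  | F, s :: l => F ((s + 1) :: l) + F (s :: 1 :: l) + stuffleSum (fun t => F (s :: t)) l

theorem stuffleSum_mul_sum {ι : Type*} (a : ℝ) (S : Finset ι) (G : ι → List ℕ → ℝ) (l : List ℕ) :
    stuffleSum (fun t => a * ∑ e ∈ S, G e t) l = a * ∑ e ∈ S, stuffleSum (G e) l := by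
  induction l generalizing G with
  | nil => simp [stuffleSum]
  | cons s l ih =>
    simp only [stuffleSum]
    rw [ih fun e t => G e (s :: t)]
    simp only [Finset.sum_add_distrib, mul_add]

/-- Pairs (a,b) below c are split into a > b and a ≤ b; in the first group the larger index a is
renamed. -/
theorem sum_range_mul_sum_range_inv (w : ℕ → ℝ) (c : ℕ) :
    (∑ b ∈ Finset.range c, w b) * ∑ a ∈ Finset.range c, (a : ℝ)⁻¹ =
      ∑ b ∈ Finset.range c, ((b : ℝ)⁻¹ * (∑ x ∈ Finset.range b, w x) +
        w b * ∑ a ∈ Finset.range (b + 1), (a : ℝ)⁻¹) := by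
  induction c with
  | zero => simp
  | succ c ih =>
    rw [Finset.sum_range_succ _ c, Finset.sum_range_succ _ c, Finset.sum_range_succ _ c, ← ih,
      Finset.sum_range_succ _ c]
    ring

/-- The stuffle product of a multiple zeta value with a truncation of `ζ(1)`. -/
theorem mzvLayer_mul_sum_inv (l : List ℕ) (c : ℕ) :
    mzvLayer l c * ∑ a ∈ Finset.range (c + 1), (a : ℝ)⁻¹ = stuffleSum (mzvLayer · c) l := by
  induction l generalizing c with
  | nil =>
    by_cases h : c = 0 <;> simp [mzvLayer, stuffleSum, h]
  | cons s l ih =>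
    have h := sum_range_mul_sum_range_inv (mzvLayer l) c
    simp only [stuffleSum, mzvLayer, pow_one]
    rw [stuffleSum_mul_sum _ _ fun e t => mzvLayer t e]
    simp only [← ih]
    -- The term a = c raises the first exponent; the terms a < c insert a 1 right after it or act on
    -- the tail.
    rw [Finset.sum_range_succ, mul_add, mul_assoc, h, Finset.sum_add_distrib, pow_succ, mul_inv]
    ring

theorem sum_raise_insert_eq_stuffleSum (F : List ℕ → ℝ) (k : ℕ → ℕ) (m a : ℕ) (ha : 1 ≤ a) :
    ∑ j ∈ Finset.Icc a m, (F (seg k a (j - 1) ++ (k j + 1) :: seg k (j + 1) m) +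
      F (seg k a j ++ 1 :: seg k (j + 1) m)) = stuffleSum F (seg k a m) := by
  induction h : m + 1 - a generalizing a F with
  | zero =>
    rw [Finset.Icc_eq_empty (by omega), seg_of_lt k (by omega)]
    rfl
  | succ t ih =>
    have ham : a ≤ m := by omega
    rw [seg_of_le k ham, stuffleSum, ← ih _ (a + 1) (by omega) (by omega),
      ← Finset.Ioc_insert_left ham, ← Finset.Icc_add_one_left_eq_Ioc,
      Finset.sum_insert (by simp)]
    congr 1
    -- For j = a the prefix ends at a - 1 and is empty; this is where a ≥ 1 matters, the subtraction
    -- being truncated.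
    · rw [seg_of_le k le_rfl, seg_of_lt k (Nat.lt_succ_self a),
        seg_of_lt k (by omega : a - 1 < a)]
      rfl
    · refine Finset.sum_congr rfl fun j hj => ?_
      rw [Finset.mem_Icc] at hj
      rw [seg_of_le k (by omega : a ≤ j - 1), seg_of_le k (by omega : a ≤ j)]
      rfl

/-! ### Regularisation for k_1 = 1. -/

/-- The value is H_c, since the summand a = 0 is 0⁻¹ = 0. Passing from c to c + 1 adds a telescoping
series with sum 1/(c+1). -/
theorem hasSum_inv_sub_inv (c : ℕ) :
    HasSum (fun a : ℕ => ((a + 1 : ℕ) : ℝ)⁻¹ - ((a + 1 + c : ℕ) : ℝ)⁻¹)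
      (∑ a ∈ Finset.range (c + 1), (a : ℝ)⁻¹) := by
  induction c with
  | zero => simp
  | succ c ih =>
    have h : HasSum (fun a : ℕ => ((a + (c + 1) : ℕ) : ℝ)⁻¹ - ((a + 1 + (c + 1) : ℕ) : ℝ)⁻¹)
        (((c + 1 : ℕ) : ℝ)⁻¹) := by
      rw [hasSum_iff_tendsto_nat_of_nonneg]
      · simp only [Finset.sum_range_sub' fun a : ℕ => ((a + (c + 1) : ℕ) : ℝ)⁻¹]
        have := (Filter.tendsto_add_atTop_iff_nat (c + 1)).2
          (tendsto_inv_atTop_nhds_zero_nat (𝕜 := ℝ))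
        simpa using this.const_sub (((c + 1 : ℕ) : ℝ)⁻¹)
      · intro a
        rw [sub_nonneg]
        exact inv_anti₀ (by positivity) (by exact_mod_cast (by omega))
    rw [Finset.sum_range_succ]
    convert ih.add h using 2 with a
    rw [show a + 1 + c = a + (c + 1) by omega]
    ring

/-- Tonelli for the nonnegative double series of w_c (1/a - 1/(a+c)), a ≥ 1: summed over a first it
gives w_c H_c, grouped by d = a + c it gives the layers. -/
theorem hasSum_sum_range_inv_sub_inv_mul {w : ℕ → ℝ} (hw : ∀ c, 0 ≤ w c) {S : ℝ}
    (h : HasSum (fun c => w c * ∑ a ∈ Finset.range (c + 1), (a : ℝ)⁻¹) S) :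
    HasSum (fun d => ∑ c ∈ Finset.range d, (((d - c : ℕ) : ℝ)⁻¹ - (d : ℝ)⁻¹) * w c) S := by
  let F : ℕ × ℕ → ℝ := fun x =>
    w x.1 * (((x.2 + 1 : ℕ) : ℝ)⁻¹ - ((x.2 + 1 + x.1 : ℕ) : ℝ)⁻¹)
  have hF : 0 ≤ F := fun x => mul_nonneg (hw _) (sub_nonneg.2
    (inv_anti₀ (by positivity) (Nat.cast_le.2 (Nat.le_add_right _ _))))
  have hfib : ∀ c, HasSum (fun a => F (c, a)) (w c * ∑ a ∈ Finset.range (c + 1), (a : ℝ)⁻¹) :=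
    fun c => (hasSum_inv_sub_inv c).mul_left (w c)
  have hsum : Summable F := (summable_prod_of_nonneg hF).2
    ⟨fun c => (hfib c).summable, by simpa only [(hfib _).tsum_eq] using h.summable⟩
  have hS : HasSum F S := by
    have := hsum.hasSum
    rwa [(this.prod_fiberwise hfib).unique h] at this
  have hanti := (Finset.HasAntidiagonal.sigmaAntidiagonalEquivProd.hasSum_iff.2 hS).sigma
    fun d => hasSum_fintype _
  -- The second coordinate of `F` is a - 1, so antidiagonal d corresponds to level d + 1; level 0 is
  -- an empty sum.
  rw [← hasSum_nat_add_iff' 1]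
  simp only [Finset.sum_range_one, Finset.range_zero, Finset.sum_empty, sub_zero]
  refine hanti.congr_fun fun d => ?_
  refine Eq.trans ?_ (Finset.sum_attach (Finset.HasAntidiagonal.antidiagonal d) F).symm
  rw [Finset.Nat.sum_antidiagonal_eq_sum_range_succ_mk]
  refine Finset.sum_congr rfl fun c hc => ?_
  have := Finset.mem_range.1 hc
  simp only [F]
  rw [show d - c + 1 = d + 1 - c by omega, show d + 1 - c + c = d + 1 by omega]
  ring

/-! ### Convergence of all series that occur, and summation over the layers. -/

theorem seg_pos {k : ℕ → ℕ} {a m : ℕ} (hk : ∀ i ∈ Finset.Icc a m, 1 ≤ k i) :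
    ∀ x ∈ seg k a m, 1 ≤ x := by
  intro x hx
  obtain ⟨j, hj, rfl⟩ := List.mem_map.1 hx
  rw [List.mem_range'_1] at hj
  exact hk j (Finset.mem_Icc.2 (by omega))

theorem advance_pos {k : ℕ → ℕ} {m a : ℕ} (hk : ∀ i ∈ Finset.Icc 1 (m + 1), 1 ≤ k i)
    (ha : 1 ≤ a) : ∀ i ∈ Finset.Icc 1 m, 1 ≤ advance k a i := by
  intro i hi
  rw [Finset.mem_Icc] at hi
  unfold advance
  split_ifs
  · exact ha
  · exact hk _ (Finset.mem_Icc.2 (by omega))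

theorem mem_chains_succ {r b : ℕ} {l : List ℕ} (hl : l ∈ chains (r + 1) b) :
    ∃ a t, 1 ≤ a ∧ a ≤ b ∧ t ∈ chains r a ∧ l = a :: t := by
  simp only [chains, Finset.mem_biUnion, Finset.mem_Icc, Finset.mem_image] at hl
  obtain ⟨a, ⟨h1, h2⟩, t, ht, rfl⟩ := hl
  exact ⟨a, t, h1, h2, ht, rfl⟩

theorem shiftArgs_one (k : ℕ → ℕ) (m q : ℕ) :
    shiftArgs k m 1 (idx k [q]) = (k 2 + k 1 - q) :: q :: seg k 3 m := by
  simp [shiftArgs, idx]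

theorem shiftArgs_middle_pos (κ : ℕ) {m : ℕ} {k : ℕ → ℕ} (hk : ∀ i ∈ Finset.Icc 1 m, 1 ≤ k i)
    (hκ : κ + 2 ≤ m) {l : List ℕ} (hl : l ∈ chains κ (k 1)) {q : ℕ}
    (hq : q ∈ Finset.Icc 1 (k (κ + 2))) :
    ∀ x ∈ shiftArgs k m (κ + 1) (idx k (l ++ [q])), 1 ≤ x := by
  induction κ generalizing m k l with
  | zero =>
    obtain rfl : l = [] := by simpa [chains] using hl
    rw [Finset.mem_Icc] at hq
    have h1 := hk 1 (Finset.mem_Icc.2 (by omega))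
    rw [List.nil_append, shiftArgs_one]
    simp only [List.forall_mem_cons]
    refine ⟨by simp only [zero_add] at hq; omega, hq.1, seg_pos fun i hi => hk i ?_⟩
    rw [Finset.mem_Icc] at hi ⊢
    omega
  | succ κ ih =>
    obtain ⟨a, t, ha, hab, ht, rfl⟩ := mem_chains_succ hl
    obtain ⟨m, rfl⟩ := Nat.exists_eq_add_of_le' (show 1 ≤ m by omega)
    have h2 := hk 2 (Finset.mem_Icc.2 (by omega))
    rw [List.cons_append, shiftArgs_succ]
    simp only [List.forall_mem_cons]
    refine ⟨by omega, ih (advance_pos hk ha) (by omega) ?_ ?_⟩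
    · simpa [advance] using ht
    · simpa [advance] using hq

theorem shiftArgs_last_pos (m : ℕ) {k : ℕ → ℕ} (hk : ∀ i ∈ Finset.Icc 1 (m + 1), 1 ≤ k i)
    {l : List ℕ} (hl : l ∈ chains m (k 1)) :
    ∀ x ∈ shiftArgs k (m + 1) m (idx k l), 1 ≤ x := by
  induction m generalizing k l with
  | zero =>
    have h1 := hk 1 (by simp)
    simpa [shiftArgs, idx, seg] using h1
  | succ m ih =>
    obtain ⟨a, t, ha, hab, ht, rfl⟩ := mem_chains_succ hl
    have h2 := hk 2 (by simp)
    rw [shiftArgs_succ]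
    simp only [List.forall_mem_cons]
    refine ⟨by omega, ih (advance_pos hk ha) ?_⟩
    simpa [advance] using ht

/-- The bound on `N` keeps the leading argument k_2 + k_1 - n of the first sum at least 2. In the
other sums n_1 ≤ k_1, so the leading argument is at least k_2 ≥ 2. -/
theorem sumsConverge {m : ℕ} (hm : 2 ≤ m) {k : ℕ → ℕ} (hk : ∀ i ∈ Finset.Icc 1 m, 1 ≤ k i)
    (hk2 : 2 ≤ k 2) {N : ℕ} (hN : N + 2 ≤ k 2 + k 1) : SumsConverge k m N := by
  obtain ⟨m, rfl⟩ := Nat.exists_eq_add_of_le' hm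
  refine ⟨fun n hn => ?_, fun κ hκ l hl q hq => ?_, fun l hl => ?_⟩
  · rw [Finset.mem_Icc] at hn
    refine mzvConverges_cons (by omega) ?_
    simp only [List.forall_mem_cons]
    refine ⟨hn.1, seg_pos fun i hi => hk i ?_⟩
    rw [Finset.mem_Icc] at hi ⊢
    omega
  · rw [Finset.mem_Icc] at hκ
    obtain ⟨κ, rfl⟩ := Nat.exists_eq_add_of_le' hκ.1
    obtain ⟨a, t, ha, hab, ht, rfl⟩ := mem_chains_succ hl
    rw [List.cons_append, shiftArgs_succ]
    refine mzvConverges_cons (by omega)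
      (shiftArgs_middle_pos κ (advance_pos hk ha) (by omega) ?_ ?_)
    · simpa [advance] using ht
    · simpa [advance] using hq
  · obtain ⟨a, t, ha, hab, ht, rfl⟩ := mem_chains_succ hl
    rw [show m + 2 - 1 = m + 1 by omega, shiftArgs_succ]
    refine mzvConverges_cons (by omega) (shiftArgs_last_pos m (advance_pos hk ha) ?_)
    simpa [advance] using ht

theorem hasSum_firstSum {k : ℕ → ℕ} {m N : ℕ}
    (h : ∀ n ∈ Finset.Icc 1 N, MZVConverges ((k 2 + k 1 - n) :: n :: seg k 3 m)) :
    HasSum (fun d => ∑ n ∈ Finset.Icc 1 N, ((k 2 + k 1 - n - 1).choose (k 1 - 1) : ℝ) *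
      mzvLayer ((k 2 + k 1 - n) :: n :: seg k 3 m) d) (firstSum k m N) :=
  hasSum_sum fun n hn => (h n hn).hasSum.mul_left _

theorem hasSum_middleTerm {k : ℕ → ℕ} {m κ : ℕ}
    (h : ∀ l ∈ chains (κ - 1) (k 1), ∀ q ∈ Finset.Icc 1 (k (κ + 1)),
      MZVConverges (shiftArgs k m κ (idx k (l ++ [q])))) :
    HasSum (fun d => middleTerm (mzvLayer · d) k m κ) (middleTerm mzv k m κ) :=
  hasSum_sum fun l hl => hasSum_sum fun q hq => (h l hl q hq).hasSum.mul_left _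

theorem hasSum_lastTerm {k : ℕ → ℕ} {m : ℕ}
    (h : ∀ l ∈ chains (m - 1) (k 1), MZVConverges (shiftArgs k m (m - 1) (idx k l))) :
    HasSum (fun d => lastTerm (mzvLayer · d) k m) (lastTerm mzv k m) :=
  hasSum_sum fun l hl => (h l hl).hasSum.mul_left _

theorem SumsConverge.hasSum {k : ℕ → ℕ} {m N : ℕ} (h : SumsConverge k m N) :
    HasSum (fun d => ∑ n ∈ Finset.Icc 1 N, ((k 2 + k 1 - n - 1).choose (k 1 - 1) : ℝ) *
        mzvLayer ((k 2 + k 1 - n) :: n :: seg k 3 m) d +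
      ∑ κ ∈ Finset.Icc 2 (m - 1), middleTerm (mzvLayer · d) k m κ +
      lastTerm (mzvLayer · d) k m) (firstSum k m N + middleSum k m + lastSum k m) :=
  ((hasSum_firstSum h.1).add (hasSum_sum fun κ hκ => hasSum_middleTerm (h.2.1 κ hκ))).add
    (hasSum_lastTerm h.2.2)

theorem mzvConv_eq {m : ℕ} (hm : 2 ≤ m) {k : ℕ → ℕ} (hk : ∀ i ∈ Finset.Icc 1 m, 1 ≤ k i)
    (d : ℕ) :
    mzvConv (k 1) (seg k 2 m) d =
      ∑ n ∈ Finset.Icc 1 (k 2), ((k 2 + k 1 - n - 1).choose (k 1 - 1) : ℝ) *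
        mzvLayer ((k 2 + k 1 - n) :: n :: seg k 3 m) d +
      ∑ κ ∈ Finset.Icc 2 (m - 1), middleTerm (mzvLayer · d) k m κ +
      lastTerm (mzvLayer · d) k m := by
  obtain ⟨m, rfl⟩ := Nat.exists_eq_add_of_le' hm
  rw [mzvConv_seg (m + 1) k hk, Finset.sum_range_succ', middleTerm_one,
    add_comm (∑ κ ∈ Finset.range m, _)]
  congr 2
  rw [show m + 2 - 1 = m + 1 by omega, Finset.range_eq_Ico, Finset.sum_Ico_add' (c := 2)
    (f := fun κ => middleTerm (mzvLayer · d) k (m + 1 + 1) κ)]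
  refine Finset.sum_congr ?_ fun _ _ => rfl
  ext i
  simp only [Finset.mem_Ico, Finset.mem_Icc]
  omega

theorem mzvConverges_seg {m : ℕ} (hm : 2 ≤ m) {k : ℕ → ℕ}
    (hk : ∀ i ∈ Finset.Icc 1 m, 1 ≤ k i) (hk2 : 2 ≤ k 2) : MZVConverges (seg k 2 m) := by
  rw [seg_of_le k hm]
  refine mzvConverges_cons hk2 (seg_pos fun i hi => hk i ?_)
  rw [Finset.mem_Icc] at hi ⊢
  omega

theorem hasSum_mzvConv {n : ℕ} {l : List ℕ} (hn : MZVConverges [n]) (hl : MZVConverges l) :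
    HasSum (mzvConv n l) (mzv [n] * mzv l) := by
  have h1 := hn.hasSum
  have h2 := hl.hasSum
  have h3 := h1.summable.mul_of_nonneg h2.summable (mzvLayer_nonneg _) (mzvLayer_nonneg _)
  have h4 := (Finset.HasAntidiagonal.sigmaAntidiagonalEquivProd.hasSum_iff.2
    (h1.mul h2 h3)).sigma fun d => hasSum_fintype _
  exact h4.congr_fun fun d => (Finset.sum_attach (Finset.HasAntidiagonal.antidiagonal d)
    fun x => mzvLayer [n] x.1 * mzvLayer l x.2).symm

theorem mzvConverges_raiseArgs_insertArgs {m j : ℕ} (hj : j ∈ Finset.Icc 2 m) {k : ℕ → ℕ}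
    (hk : ∀ i ∈ Finset.Icc 1 m, 1 ≤ k i) (hk2 : 2 ≤ k 2) :
    MZVConverges (raiseArgs k m j) ∧ MZVConverges (insertArgs k m j) := by
  rw [Finset.mem_Icc] at hj
  have hpos : ∀ a b, 1 ≤ a → b ≤ m → ∀ x ∈ seg k a b, 1 ≤ x := fun a b ha hb =>
    seg_pos fun i hi => hk i (by rw [Finset.mem_Icc] at hi ⊢; omega)
  have h3 := hpos (j + 1) m (by omega) le_rfl
  constructor
  · rw [raiseArgs]
    rcases hj.1.eq_or_lt with rfl | hj2
    · rw [seg_of_lt k (by omega)]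
      exact mzvConverges_cons (by omega) h3
    · rw [seg_of_le k (by omega : 2 ≤ j - 1), List.cons_append]
      refine mzvConverges_cons hk2 ?_
      simp only [List.forall_mem_append, List.forall_mem_cons]
      exact ⟨hpos _ _ (by omega) (by omega), by omega, h3⟩
  · rw [insertArgs, seg_of_le k hj.1, List.cons_append]
    refine mzvConverges_cons hk2 ?_
    simp only [List.forall_mem_append, List.forall_mem_cons]
    exact ⟨hpos _ _ (by omega) hj.2, le_rfl, h3⟩

/-- For k_1 = 1 the summand n = k_2 is layer d of the divergent ζ(1,k_2,…,k_m), namely 1/d times the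
sum of the layers below d; it is moved to the left. -/
theorem sum_range_inv_sub_inv_mul_mzvLayer {m : ℕ} (hm : 2 ≤ m) {k : ℕ → ℕ}
    (hk : ∀ i ∈ Finset.Icc 1 m, 1 ≤ k i) (hk1 : k 1 = 1) (d : ℕ) :
    ∑ c ∈ Finset.range d, (((d - c : ℕ) : ℝ)⁻¹ - (d : ℝ)⁻¹) * mzvLayer (seg k 2 m) c =
      ∑ n ∈ Finset.Icc 1 (k 2 - 1), ((k 2 + k 1 - n - 1).choose (k 1 - 1) : ℝ) *
        mzvLayer ((k 2 + k 1 - n) :: n :: seg k 3 m) d +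
      ∑ κ ∈ Finset.Icc 2 (m - 1), middleTerm (mzvLayer · d) k m κ +
      lastTerm (mzvLayer · d) k m := by
  have h2 : 1 ≤ k 2 := hk 2 (Finset.mem_Icc.2 (by omega))
  have h := mzvConv_eq hm hk d
  rw [mzvConv_eq_sum_range hk1.ge, ← Finset.insert_Icc_sub_one_right_eq_Icc h2,
    Finset.sum_insert (by simp; omega)] at h
  have h3 : mzvLayer ((k 2 + k 1 - k 2) :: k 2 :: seg k 3 m) d =
      (d : ℝ)⁻¹ * ∑ c ∈ Finset.range d, mzvLayer (seg k 2 m) c := by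
    rw [Nat.add_sub_cancel_left, hk1, seg_of_le k hm, mzvLayer, pow_one]
  rw [h3, hk1] at h
  simp only [sub_mul, Finset.sum_sub_distrib, ← Finset.mul_sum]
  simp only [hk1, Nat.sub_self, Nat.choose_zero_right, Nat.cast_one, one_mul, pow_one] at h ⊢
  linarith

theorem mainTheorem3 (m : ℕ) (hm : 2 ≤ m) (k : ℕ → ℕ)
    (hk : ∀ i ∈ Finset.Icc 1 m, 1 ≤ k i) (hk2 : 2 ≤ k 2) :
    (2 ≤ k 1 →
      MZVConverges [k 1] ∧ MZVConverges (seg k 2 m) ∧ SumsConverge k m (k 2) ∧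
      mzv [k 1] * mzv (seg k 2 m) = firstSum k m (k 2) + middleSum k m + lastSum k m) ∧
    (k 1 = 1 →
      (∀ j ∈ Finset.Icc 2 m,
        MZVConverges (raiseArgs k m j) ∧ MZVConverges (insertArgs k m j)) ∧
      SumsConverge k m (k 2 - 1) ∧
      ∑ j ∈ Finset.Icc 2 m, (mzv (raiseArgs k m j) + mzv (insertArgs k m j)) =
        firstSum k m (k 2 - 1) + middleSum k m + lastSum k m) := by
  refine ⟨fun hk1 => ?_, fun hk1 => ?_⟩
  · have h1 : MZVConverges [k 1] := mzvConverges_cons hk1 (by simp)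
    have h2 := mzvConverges_seg hm hk hk2
    have h3 : SumsConverge k m (k 2) := sumsConverge hm hk hk2 (by omega)
    exact ⟨h1, h2, h3, (hasSum_mzvConv h1 h2).unique (h3.hasSum.congr_fun (mzvConv_eq hm hk))⟩
  · have h1 := fun j hj => mzvConverges_raiseArgs_insertArgs (j := j) hj hk hk2
    have h2 : SumsConverge k m (k 2 - 1) := sumsConverge hm hk hk2 (by omega)
    refine ⟨h1, h2, ?_⟩
    have h3 : HasSum (fun c => mzvLayer (seg k 2 m) c *
        ∑ a ∈ Finset.range (c + 1), (a : ℝ)⁻¹)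
        (∑ j ∈ Finset.Icc 2 m, (mzv (raiseArgs k m j) + mzv (insertArgs k m j))) := by
      simp only [mzvLayer_mul_sum_inv]
      simp only [← sum_raise_insert_eq_stuffleSum _ k m 2 one_le_two]
      exact hasSum_sum fun j hj => (h1 j hj).1.hasSum.add (h1 j hj).2.hasSum
    exact (hasSum_sum_range_inv_sub_inv_mul (mzvLayer_nonneg _) h3).unique
      (h2.hasSum.congr_fun (sum_range_inv_sub_inv_mul_mzvLayer hm hk hk1))
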